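/- Let $\Omega\subset\mathbb R^2$ be a bounded Lipschitz domain, $f\in L^2(\Omega)$, and let $u\in H^1_0(\Omega)$ satisfy $(\nabla u,\nabla v)=(f,v)$ for all $v\in H^1_0(\Omega)$, where $(\cdot,\cdot)_D$ is the $L^2(D)$ inner product and $D=\Omega$ is omitted. Assume $u\in C^0(\overline\Omega)$. Let $\mathcal T_h$ be a decomposition of $\Omega$ into finitely many pairwise disjoint simple polygons $K$, i.e. open simply connected bounded sets with non-self-intersecting polygonal boundary. Define $$V_K=\{v\in H^1(K): v|_{\partial K}\in C^0(\partial K),\ v|_e\in\mathbb P_1(e)\text{ for every edge }e\subset\partial K,\ \Delta v=0\text{ in }K\},$$ $$V_h=\{v\in H^1_0(\Omega): v|_K\in V_K\text{ for all }K\in\mathcal T_h\}.$$ For $v\in H^1(K)$ let $\Pi v=\Pi_K v\in\mathbb P_1(K)$ be determined by $(\nabla(v-\Pi v),\nabla p)_K=0$ for all $p\in\mathbb P_1(K)$ and $\int_{\partial K}(v-\Pi v)\,ds=0$; on $\Omega$ the operator $\Pi$ is applied on each $K$ separately. For each $K$ let $S_K$ be any bilinear form on $V_K$, and put $$a_h(w,v)=\sum_{K\in\mathcal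 T_h}(\nabla\Pi w,\nabla\Pi v)_K+\sum_{K\in\mathcal T_h}S_K(w-\Pi w,v-\Pi v).$$ Let $u_h\in V_h$ be a solution of $a_h(u_h,v_h)=(f,\Pi v_h)$ for all $v_h\in V_h$, and let $u_I\in V_h$ be the nodal interpolant of $u$, i.e. $u_I(\boldsymbol a)=u(\boldsymbol a)$ at every vertex $\boldsymbol a$ of every $K\in\mathcal T_h$. Let $\boldsymbol n$ be the outward unit normal on $\partial K$, and for $w\in L^2(K)^2$ with $\operatorname{div}w\in L^2(K)$ and $\varphi\in H^1(K)$ let $\langle w\cdot\boldsymbol n,\varphi\rangle_{\partial K}=(w,\nabla\varphi)_K+(\operatorname{div}w,\varphi)_K$ be the duality pairing between $H^{-1/2}(\partial K)$ and $H^{1/2}(\partial K)$. Then for every $v_h\in V_h$ $$\begin{aligned}a_h(u_h-u_I,v_h)={}&\sum_{K\in\mathcal T_h}(\nabla\Pi(u-u_I),\nabla\Pi v_h)_K-\sum_{K\in\mathcal T_h}S_K(u_I-\Pi u_I,\,v_h-\Pi v_h)\\&+\sum_{K\in\mathcal T_h}\langle\nabla(u-\Pi u)\cdot\boldsymbol n,\,v_h-\Pi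 v_h\rangle_{\partial K}.\end{aligned}$$ -/

import Mathlib

open MeasureTheory Filter Topology
open scoped ContDiff

noncomputable section

namespace VEM

/-- The Euclidean plane. -/
abbrev Plane : Type := EuclideanSpace ℝ (Fin 2)

/-! ### Sobolev spaces

Functions on an open set `U` are represented by functions on the whole plane, of which only the
values on `U` (up to null sets) matter. -/

/-- `φ ∈ C_c^∞(U)`. -/
structure IsTest (U : Set Plane) (φ : Plane → ℝ) : Prop where
  smooth : ContDiff ℝ ∞ φ
  compact : HasCompactSupport φ
  support : tsupport φ ⊆ U

/-- `G ∈ L²(U)²` is the weak gradient of `v` in `U`. -/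
def HasWeakGrad (U : Set Plane) (v : Plane → ℝ) (G : Plane → Plane) : Prop :=
  MemLp G 2 (volume.restrict U) ∧
    ∀ φ : Plane → ℝ, IsTest U φ →
      ∫ x in U, v x • gradient φ x = -∫ x in U, φ x • G x

open Classical in
/-- The weak gradient `∇v` in `U` (zero if `v` has no weak gradient in `L²(U)²`). -/
def weakGrad (U : Set Plane) (v : Plane → ℝ) : Plane → Plane :=
  if h : ∃ G, HasWeakGrad U v G then h.choose else 0

/-- `v ∈ H¹(U)`. -/
def MemH1 (U : Set Plane) (v : Plane → ℝ) : Prop :=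
  MemLp v 2 (volume.restrict U) ∧ ∃ G, HasWeakGrad U v G

/-- `v ∈ H¹₀(U)`: the closure of `C_c^∞(U)` in `H¹(U)`. -/
def MemH10 (U : Set Plane) (v : Plane → ℝ) : Prop :=
  MemH1 U v ∧ ∃ φ : ℕ → Plane → ℝ, (∀ k, IsTest U (φ k)) ∧
    Tendsto (fun k => eLpNorm (φ k - v) 2 (volume.restrict U)) atTop (𝓝 0) ∧
    Tendsto (fun k => eLpNorm (gradient (φ k) - weakGrad U v) 2 (volume.restrict U))
      atTop (𝓝 0)

/-- `d ∈ L²(U)` is the weak divergence of the vector field `w` in `U`. -/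
def HasWeakDiv (U : Set Plane) (w : Plane → Plane) (d : Plane → ℝ) : Prop :=
  MemLp d 2 (volume.restrict U) ∧
    ∀ φ : Plane → ℝ, IsTest U φ →
      ∫ x in U, inner ℝ (w x) (gradient φ x) = -∫ x in U, d x * φ x

open Classical in
/-- The weak divergence of `w` in `U` (zero if `w` has no weak divergence in `L²(U)`). -/
def weakDiv (U : Set Plane) (w : Plane → Plane) : Plane → ℝ :=
  if h : ∃ d, HasWeakDiv U w d then h.choose else 0

/-- The duality pairing `⟨w · n, φ⟩_{∂U}` between the normal trace in `H^{-1/2}(∂U)` of a field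
`w ∈ H(div; U)` and the trace in `H^{1/2}(∂U)` of a function `φ ∈ H¹(U)`, where `n` is the outward
unit normal. For `w` of mere `H(div; U)` regularity the normal trace is the functional
`φ ↦ (w, ∇φ)_U + (div w, φ)_U`; it vanishes on `H¹₀(U)` (see `normalPairing_eq_zero`), so that it
acts on boundary values only. -/
def normalPairing (U : Set Plane) (w : Plane → Plane) (φ : Plane → ℝ) : ℝ :=
  (∫ x in U, inner ℝ (w x) (weakGrad U φ x)) + ∫ x in U, weakDiv U w x * φ x

/-! ### Traces -/

/-- Arc length on the boundary of `U`. -/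
def arcLength (U : Set Plane) : Measure Plane := (Measure.hausdorffMeasure 1).restrict (frontier U)

/-- `g` is the trace of `v ∈ H¹(U)` on `∂U`, for a Lipschitz domain `U`: almost everywhere with
respect to arc length, `g x` is the limit in mean of `v` at `x` from inside `U`. This depends only
on the class of `v` modulo null sets, and `g = v` if `v` is continuous on the closure of `U`. -/
def HasTrace (U : Set Plane) (v g : Plane → ℝ) : Prop :=
  ∀ᵐ x ∂(arcLength U),
    Tendsto (fun r : ℝ => ⨍ y in U ∩ Metric.ball x r, |v y - g x|) (𝓝[>] 0) (𝓝 0)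

/-! ### Polygons and meshes -/

/-- A simple polygon: an open bounded simply connected set whose boundary is a closed
non-self-intersecting polygonal curve with vertices `vertex 0, …, vertex (n - 1)`. Consecutive
edges may be collinear. -/
structure SimplePolygon where
  n : ℕ
  three_le : 3 ≤ n
  vertex : Fin n → Plane
  /-- The closed curve that runs through the edges is injective. -/
  simple : ∀ i j : Fin n, ∀ s ∈ Set.Ico (0 : ℝ) 1, ∀ t ∈ Set.Ico (0 : ℝ) 1,
    AffineMap.lineMap (vertex i) (vertex (finRotate n i)) s =
      AffineMap.lineMap (vertex j) (vertex (finRotate n j)) t → i = j ∧ s = t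
  carrier : Set Plane
  isOpen : IsOpen carrier
  isBounded : Bornology.IsBounded carrier
  simplyConnected : SimplyConnectedSpace carrier
  frontier_eq : frontier carrier = ⋃ i, segment ℝ (vertex i) (vertex (finRotate n i))

/-- The closed edge from `vertex i` to the next vertex. -/
def SimplePolygon.edge (K : SimplePolygon) (i : Fin K.n) : Set Plane :=
  segment ℝ (K.vertex i) (K.vertex (finRotate K.n i))

/-- The finitely many polygons `K i` decompose `Ω`. -/
structure IsMesh {ι : Type*} (Ω : Set Plane) (K : ι → SimplePolygon) : Prop where
  subset : ∀ i, (K i).carrier ⊆ Ω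
  disjoint : ∀ i j, i ≠ j → Disjoint (K i).carrier (K j).carrier
  cover : closure Ω = ⋃ i, closure (K i).carrier

/-! ### Virtual element spaces -/

/-- `g ∈ B₁(∂K)`: continuous on `∂K` and a polynomial of degree at most one on each edge. -/
def MemB1 (K : SimplePolygon) (g : Plane → ℝ) : Prop :=
  ContinuousOn g (frontier K.carrier) ∧
    ∀ i, ∃ q : Plane →ᵃ[ℝ] ℝ, ∀ x ∈ K.edge i, g x = q x

/-- The local space `V_K`: functions in `H¹(K)` with trace in `B₁(∂K)` and `Δv = 0` in `K`
in the sense of distributions. -/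
def VK (K : SimplePolygon) : Set (Plane → ℝ) :=
  {v | MemH1 K.carrier v ∧ (∃ g, HasTrace K.carrier v g ∧ MemB1 K g) ∧
    ∀ φ, IsTest K.carrier φ →
      ∫ x in K.carrier, inner ℝ (weakGrad K.carrier v x) (gradient φ x) = 0}

/-- The global space `V_h`. -/
def Vh {ι : Type*} (Ω : Set Plane) (K : ι → SimplePolygon) : Set (Plane → ℝ) :=
  {v | MemH10 Ω v ∧ ∀ i, v ∈ VK (K i)}

/-- `uI ∈ V_h` is the nodal interpolant of the function `u`, continuous on the closure of `Ω`:
on each polygon, the (continuous) boundary values of `uI` agree with `u` at the vertices. -/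
def IsNodalInterpolant {ι : Type*} (Ω : Set Plane) (K : ι → SimplePolygon)
    (u uI : Plane → ℝ) : Prop :=
  uI ∈ Vh Ω K ∧ ∀ i, ∃ g, HasTrace (K i).carrier uI g ∧ MemB1 (K i) g ∧
    ∀ j, g ((K i).vertex j) = u ((K i).vertex j)

/-! ### The discrete problem -/

/-- `p ∈ P₁(K)` is the projection of `v` in the `H¹(K)`-seminorm, normalized by equality of the
boundary integrals. -/
def IsProj (K : SimplePolygon) (v : Plane → ℝ) (p : Plane →ᵃ[ℝ] ℝ) : Prop :=
  (∀ q : Plane →ᵃ[ℝ] ℝ,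
    ∫ x in K.carrier, inner ℝ (weakGrad K.carrier v x - gradient p x) (gradient q x) = 0) ∧
  ∃ g, HasTrace K.carrier v g ∧ Integrable g (arcLength K.carrier) ∧
    ∫ x, (g x - p x) ∂(arcLength K.carrier) = 0

open Classical in
/-- The local projection `Π = Π_K^∇`. -/
def proj (K : SimplePolygon) (v : Plane → ℝ) : Plane →ᵃ[ℝ] ℝ :=
  if h : ∃ p, IsProj K v p then h.choose else 0

/-- `v - Πv`. -/
def slice (K : SimplePolygon) (v : Plane → ℝ) : Plane → ℝ := fun x => v x - proj K v x

/-- `(∇p, ∇q)_K` for polynomials `p`, `q` of degree at most one. -/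
def gradIP (K : SimplePolygon) (p q : Plane →ᵃ[ℝ] ℝ) : ℝ :=
  ∫ x in K.carrier, inner ℝ (gradient p x) (gradient q x)

/-- `S` is a bilinear form on the set `V` of functions (in use, `V` is a linear space). -/
structure IsBilinearOn (V : Set (Plane → ℝ)) (S : (Plane → ℝ) → (Plane → ℝ) → ℝ) : Prop where
  add_left : ∀ u ∈ V, ∀ u' ∈ V, ∀ v ∈ V, S (u + u') v = S u v + S u' v
  smul_left : ∀ c : ℝ, ∀ u ∈ V, ∀ v ∈ V, S (c • u) v = c * S u v
  add_right : ∀ u ∈ V, ∀ v ∈ V, ∀ v' ∈ V, S u (v + v') = S u v + S u v'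
  smul_right : ∀ c : ℝ, ∀ u ∈ V, ∀ v ∈ V, S u (c • v) = c * S u v

/-- The discrete bilinear form `a_h` with stabilization terms `S i` on the polygons `K i`. -/
def ah {ι : Type*} [Fintype ι] (K : ι → SimplePolygon)
    (S : ι → (Plane → ℝ) → (Plane → ℝ) → ℝ) (u v : Plane → ℝ) : ℝ :=
  ∑ i, gradIP (K i) (proj (K i) u) (proj (K i) v) +
    ∑ i, S i (slice (K i) u) (slice (K i) v)

/-- `uh` is a solution of the virtual element discretization with right-hand side `f`. -/
def IsVEMSolution {ι : Type*} [Fintype ι] (Ω : Set Plane) (K : ι → SimplePolygon)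
    (S : ι → (Plane → ℝ) → (Plane → ℝ) → ℝ) (f uh : Plane → ℝ) : Prop :=
  uh ∈ Vh Ω K ∧ ∀ v ∈ Vh Ω K,
    ah K S uh v = ∑ i, ∫ x in (K i).carrier, f x * proj (K i) v x

/-- `u ∈ H¹₀(Ω)` is the weak solution of `-Δu = f` in `Ω`. -/
def IsWeakSolution (Ω : Set Plane) (f u : Plane → ℝ) : Prop :=
  MemH10 Ω u ∧ ∀ v, MemH10 Ω v →
    ∫ x in Ω, inner ℝ (weakGrad Ω u x) (weakGrad Ω v x) = ∫ x in Ω, f x * v x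

theorem IsTest.continuous_gradient {U : Set Plane} {φ : Plane → ℝ} (h : IsTest U φ) :
    Continuous (gradient φ) := by
  have h1 : Continuous (fderiv ℝ φ) := h.smooth.continuous_fderiv (by simp)
  exact (InnerProductSpace.toDual ℝ Plane).symm.continuous.comp h1

theorem IsTest.memLp {U : Set Plane} {φ : Plane → ℝ} (h : IsTest U φ) (μ : Measure Plane)
    [IsFiniteMeasureOnCompacts μ] : MemLp φ 2 μ :=
  h.smooth.continuous.memLp_of_hasCompactSupport h.compact

theorem IsTest.memLp_gradient {U : Set Plane} {φ : Plane → ℝ} (h : IsTest U φ)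
    (μ : Measure Plane) [IsFiniteMeasureOnCompacts μ] : MemLp (gradient φ) 2 μ := by
  refine h.continuous_gradient.memLp_of_hasCompactSupport ?_
  exact (h.compact.fderiv ℝ).comp_left (g := (InnerProductSpace.toDual ℝ Plane).symm) (by simp)

theorem tendsto_integral_inner {F : Type*} [NormedAddCommGroup F] [InnerProductSpace ℝ F]
    {μ : Measure Plane} {a b : Plane → F} {B : ℕ → Plane → F} (ha : MemLp a 2 μ)
    (hb : MemLp b 2 μ) (hB : ∀ k, MemLp (B k) 2 μ)
    (h : Tendsto (fun k => eLpNorm (B k - b) 2 μ) atTop (𝓝 0)) :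
    Tendsto (fun k => ∫ x, inner ℝ (a x) (B k x) ∂μ) atTop (𝓝 (∫ x, inner ℝ (a x) (b x) ∂μ)) := by
  have hi : ∀ c : Plane → F, MemLp c 2 μ → Integrable (fun x => inner ℝ (a x) (c x)) μ :=
    fun c hc => memLp_one_iff_integrable.1 ((innerSL ℝ).memLp_of_bilin 1 ha hc)
  refine tendsto_integral_of_L1' _ (hi b hb).1 (Eventually.of_forall fun k => hi _ (hB k)) ?_
  have h2 : Tendsto (fun k => eLpNorm a 2 μ * eLpNorm (B k - b) 2 μ) atTop (𝓝 0) := by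
    have := ENNReal.Tendsto.const_mul (a := eLpNorm a 2 μ) h (Or.inr ha.2.ne)
    simpa using this
  refine tendsto_of_tendsto_of_tendsto_of_le_of_le tendsto_const_nhds h2 (fun _ => zero_le)
    fun k => ?_
  have h3 := eLpNorm_le_eLpNorm_mul_eLpNorm_of_nnnorm (p := 2) (q := 2) (r := 1) ha.1
    ((hB k).sub hb).1 (fun x y => inner ℝ x y) 1
    (Eventually.of_forall fun x => by simpa using nnnorm_inner_le_nnnorm (𝕜 := ℝ) _ _)
  have h4 : ((fun x => inner ℝ (a x) (B k x)) - fun x => inner ℝ (a x) (b x)) =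
      fun x => inner ℝ (a x) ((B k - b) x) := by
    funext x
    simp [inner_sub_right]
  rw [h4]
  simpa using h3

/-- The pairing `⟨w · n, φ⟩_{∂U}` vanishes for `φ ∈ H¹₀(U)`. -/
theorem normalPairing_eq_zero {U : Set Plane} {w : Plane → Plane} {φ : Plane → ℝ}
    (hw : MemLp w 2 (volume.restrict U)) (hd : ∃ d, HasWeakDiv U w d) (hφ : MemH10 U φ) :
    normalPairing U w φ = 0 := by
  obtain ⟨⟨hφ2, hG⟩, ψ, hψ, h1, h2⟩ := hφ
  have hwd : HasWeakDiv U w (weakDiv U w) := by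
    unfold weakDiv
    rw [dif_pos hd]
    exact hd.choose_spec
  have hg : HasWeakGrad U φ (weakGrad U φ) := by
    unfold weakGrad
    rw [dif_pos hG]
    exact hG.choose_spec
  have t1 := tendsto_integral_inner hw hg.1 (fun k => (hψ k).memLp_gradient _) h2
  have t2 := tendsto_integral_inner hwd.1 hφ2 (fun k => (hψ k).memLp _) h1
  have t3 := t1.add t2
  have t4 : ∀ k, (∫ x in U, inner ℝ (w x) (gradient (ψ k) x)) +
      ∫ x in U, inner ℝ (weakDiv U w x) (ψ k x) = 0 := by
    intro k
    rw [hwd.2 _ (hψ k)]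
    simp [mul_comm]
  simp only [t4] at t3
  have t5 := tendsto_nhds_unique t3 tendsto_const_nhds
  rw [normalPairing, ← t5]
  simp [mul_comm]

end VEM

end

noncomputable section

namespace VEM

/-! ### Weak derivatives -/

/-! Write `v` for `vh`. On one polygon `K`, `∇Πu` is constant, so `div ∇(u - Πu) = Δu = -f` and the
boundary pairing is by definition `(∇(u - Πu), ∇(v - Πv))_K - (f, v - Πv)_K`. The definition of `Π`
turns the first term into `(∇u, ∇v)_K - (∇Πu, ∇Πv)_K` (`integral_inner_weakGrad_slice`,
`IsWeakSolution.normalPairing_slice`). Sum over the mesh. Since `v ∈ H¹₀(Ω)`, the weak equation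
cancels `(∇u, ∇v)` against `(f, v)`, leaving `(f, Πv) = ∑ (∇Πu, ∇Πv)_K + ∑ ⟨∇(u - Πu) · n, v - Πv⟩`.
The left side is `a_h(u_h, v)`, and subtracting `a_h(u_I, v)` gives the identity, by linearity of
`Π` and of `a_h` (`proj_sub`, `ah_sub_left`). The analytic work lies in the objects picked by
choice. Weak gradients and divergences are unique almost everywhere, traces are unique along `∂K`,
and `Π` exists and is unique because it amounts to prescribing the mean gradient and the boundary
integral (`isProj_iff_of_hasTrace`). The sum over polygons is an integral over `Ω` because polygon
boundaries are null sets (`IsMesh.sum_setIntegral`). -/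

theorem inner_gradient_eq_fderiv (φ : Plane → ℝ) (x e : Plane) :
    inner ℝ e (gradient φ x) = fderiv ℝ φ x e := by
  rw [real_inner_comm, gradient, InnerProductSpace.toDual_symm_apply]

theorem gradient_eq_zero_of_notMem_tsupport {φ : Plane → ℝ} {x : Plane} (hx : x ∉ tsupport φ) :
    gradient φ x = 0 := by
  have h : fderiv ℝ φ x = 0 := by
    by_contra h
    exact hx (support_fderiv_subset ℝ h)
  simp [gradient, h]

theorem MemLp.integrable_smul_of_two {μ : Measure Plane} {F : Type*} [NormedAddCommGroup F]
    [NormedSpace ℝ F] {a : Plane → ℝ} {b : Plane → F} (ha : MemLp a 2 μ) (hb : MemLp b 2 μ) :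
    Integrable (fun x => a x • b x) μ :=
  memLp_one_iff_integrable.1 (hb.smul ha)

theorem MemLp.integrable_mul_of_two {μ : Measure Plane} {a b : Plane → ℝ} (ha : MemLp a 2 μ)
    (hb : MemLp b 2 μ) : Integrable (fun x => a x * b x) μ :=
  MemLp.integrable_smul_of_two ha hb

theorem MemLp.integrable_inner_of_two {μ : Measure Plane} {F : Type*} [NormedAddCommGroup F]
    [InnerProductSpace ℝ F] {a b : Plane → F} (ha : MemLp a 2 μ) (hb : MemLp b 2 μ) :
    Integrable (fun x => inner ℝ (a x) (b x)) μ :=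
  memLp_one_iff_integrable.1 ((innerSL ℝ).memLp_of_bilin 1 ha hb)

theorem IsTest.mono {U W : Set Plane} {φ : Plane → ℝ} (h : IsTest U φ) (hUW : U ⊆ W) :
    IsTest W φ :=
  ⟨h.smooth, h.compact, h.support.trans hUW⟩

theorem IsTest.eq_zero {U : Set Plane} {φ : Plane → ℝ} (h : IsTest U φ) {x : Plane}
    (hx : x ∉ U) : φ x = 0 :=
  image_eq_zero_of_notMem_tsupport fun hx' => hx (h.support hx')

theorem IsTest.gradient_eq_zero {U : Set Plane} {φ : Plane → ℝ} (h : IsTest U φ) {x : Plane}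
    (hx : x ∉ U) : gradient φ x = 0 :=
  gradient_eq_zero_of_notMem_tsupport fun hx' => hx (h.support hx')

/-- The fundamental lemma of the calculus of variations; it makes the chosen `weakGrad` and
`weakDiv` unique up to null sets. -/
theorem ae_eq_of_integral_smul_test_eq {F : Type*} [NormedAddCommGroup F] [NormedSpace ℝ F]
    [CompleteSpace F] {U : Set Plane} (hU : IsOpen U) {G G' : Plane → F}
    (hG : MemLp G 2 (volume.restrict U)) (hG' : MemLp G' 2 (volume.restrict U))
    (h : ∀ φ, IsTest U φ → ∫ x in U, φ x • G x = ∫ x in U, φ x • G' x) :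
    G =ᵐ[volume.restrict U] G' := by
  have hl : LocallyIntegrableOn (G - G') U volume :=
    locallyIntegrableOn_of_locallyIntegrable_restrict ((hG.sub hG').locallyIntegrable (by norm_num))
  have h0 := hU.ae_eq_zero_of_integral_contDiff_smul_eq_zero hl fun φ h1 h2 h3 => by
    have hφ : IsTest U φ := ⟨h1, h2, h3⟩
    rw [← setIntegral_eq_integral_of_forall_compl_eq_zero (s := U)
      fun x hx => by rw [hφ.eq_zero hx, zero_smul]]
    simp only [Pi.sub_apply, smul_sub]
    rw [integral_sub (MemLp.integrable_smul_of_two (hφ.memLp _) hG)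
      (MemLp.integrable_smul_of_two (hφ.memLp _) hG'), h φ hφ, sub_self]
  rw [EventuallyEq, ae_restrict_iff' hU.measurableSet]
  filter_upwards [h0] with x hx hxU
  exact sub_eq_zero.1 (hx hxU)

theorem HasWeakGrad.unique {U : Set Plane} (hU : IsOpen U) {v : Plane → ℝ} {G G' : Plane → Plane}
    (h : HasWeakGrad U v G) (h' : HasWeakGrad U v G') : G =ᵐ[volume.restrict U] G' :=
  ae_eq_of_integral_smul_test_eq hU h.1 h'.1 fun φ hφ => by
    rw [← neg_inj, ← h.2 φ hφ, h'.2 φ hφ]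

theorem HasWeakDiv.unique {U : Set Plane} (hU : IsOpen U) {w : Plane → Plane} {d d' : Plane → ℝ}
    (h : HasWeakDiv U w d) (h' : HasWeakDiv U w d') : d =ᵐ[volume.restrict U] d' :=
  ae_eq_of_integral_smul_test_eq hU h.1 h'.1 fun φ hφ => by
    simp only [smul_eq_mul, mul_comm (φ _)]
    rw [← neg_inj, ← h.2 φ hφ, h'.2 φ hφ]

theorem hasWeakGrad_weakGrad {U : Set Plane} {v : Plane → ℝ} (h : ∃ G, HasWeakGrad U v G) :
    HasWeakGrad U v (weakGrad U v) := by
  rw [weakGrad, dif_pos h]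
  exact h.choose_spec

theorem hasWeakDiv_weakDiv {U : Set Plane} {w : Plane → Plane} (h : ∃ d, HasWeakDiv U w d) :
    HasWeakDiv U w (weakDiv U w) := by
  rw [weakDiv, dif_pos h]
  exact h.choose_spec

theorem HasWeakGrad.weakGrad_ae_eq {U : Set Plane} (hU : IsOpen U) {v : Plane → ℝ}
    {G : Plane → Plane} (h : HasWeakGrad U v G) : weakGrad U v =ᵐ[volume.restrict U] G :=
  (hasWeakGrad_weakGrad ⟨G, h⟩).unique hU h

theorem HasWeakGrad.sub {U : Set Plane} {v w : Plane → ℝ} {G H : Plane → Plane}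
    (hv : MemLp v 2 (volume.restrict U)) (hw : MemLp w 2 (volume.restrict U))
    (h : HasWeakGrad U v G) (h' : HasWeakGrad U w H) : HasWeakGrad U (v - w) (G - H) := by
  refine ⟨h.1.sub h'.1, fun φ hφ => ?_⟩
  simp only [Pi.sub_apply, sub_smul, smul_sub]
  rw [integral_sub (MemLp.integrable_smul_of_two hv (hφ.memLp_gradient _))
      (MemLp.integrable_smul_of_two hw (hφ.memLp_gradient _)),
    integral_sub (MemLp.integrable_smul_of_two (hφ.memLp _) h.1)
      (MemLp.integrable_smul_of_two (hφ.memLp _) h'.1), h.2 φ hφ, h'.2 φ hφ]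
  abel

/-- A test function on `U` is one on `W`, and both sets of integrals equal integrals over the whole
plane because the integrands vanish outside `U`. -/
theorem HasWeakGrad.mono {U W : Set Plane} (hUW : U ⊆ W) {v : Plane → ℝ} {G : Plane → Plane}
    (h : HasWeakGrad W v G) : HasWeakGrad U v G := by
  refine ⟨h.1.mono_measure (Measure.restrict_mono_set _ hUW), fun φ hφ => ?_⟩
  have h1 := h.2 φ (hφ.mono hUW)
  rwa [setIntegral_eq_integral_of_forall_compl_eq_zero
      (fun x hx => by rw [(hφ.mono hUW).gradient_eq_zero hx, smul_zero]),
    setIntegral_eq_integral_of_forall_compl_eq_zero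
      (fun x hx => by rw [(hφ.mono hUW).eq_zero hx, zero_smul]),
    ← setIntegral_eq_integral_of_forall_compl_eq_zero (s := U)
      (fun x hx => by rw [hφ.gradient_eq_zero hx, smul_zero]),
    ← setIntegral_eq_integral_of_forall_compl_eq_zero (s := U) (f := fun x => φ x • G x)
      (fun x hx => by rw [hφ.eq_zero hx, zero_smul])] at h1

theorem MemH1.mono {U W : Set Plane} (hUW : U ⊆ W) {v : Plane → ℝ} (h : MemH1 W v) : MemH1 U v :=
  ⟨h.1.mono_measure (Measure.restrict_mono_set _ hUW), h.2.imp fun _ => HasWeakGrad.mono hUW⟩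

theorem MemH1.hasWeakGrad {U : Set Plane} {v : Plane → ℝ} (h : MemH1 U v) :
    HasWeakGrad U v (weakGrad U v) :=
  hasWeakGrad_weakGrad h.2

theorem MemH1.sub {U : Set Plane} {v w : Plane → ℝ} (hv : MemH1 U v) (hw : MemH1 U w) :
    MemH1 U (v - w) :=
  ⟨hv.1.sub hw.1, _, hv.hasWeakGrad.sub hv.1 hw.1 hw.hasWeakGrad⟩

theorem MemH1.weakGrad_sub {U : Set Plane} (hU : IsOpen U) {v w : Plane → ℝ} (hv : MemH1 U v)
    (hw : MemH1 U w) :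
    weakGrad U (v - w) =ᵐ[volume.restrict U] weakGrad U v - weakGrad U w :=
  (hv.hasWeakGrad.sub hv.1 hw.1 hw.hasWeakGrad).weakGrad_ae_eq hU

theorem hasWeakGrad_gradient {U : Set Plane} {v : Plane → ℝ} (hv : ContDiff ℝ ∞ v)
    (h2 : MemLp (gradient v) 2 (volume.restrict U)) : HasWeakGrad U v (gradient v) := by
  refine ⟨h2, fun φ hφ => ?_⟩
  rw [setIntegral_eq_integral_of_forall_compl_eq_zero
      (fun x hx => by rw [hφ.gradient_eq_zero hx, smul_zero]),
    setIntegral_eq_integral_of_forall_compl_eq_zero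
      (fun x hx => by rw [hφ.eq_zero hx, zero_smul])]
  have hgv : Continuous (gradient v) :=
    (InnerProductSpace.toDual ℝ Plane).symm.continuous.comp (hv.continuous_fderiv (by simp))
  have hcg : HasCompactSupport (gradient φ) :=
    (hφ.compact.fderiv ℝ).comp_left (g := (InnerProductSpace.toDual ℝ Plane).symm) (by simp)
  have i1 : Integrable (fun x => v x • gradient φ x) :=
    (hv.continuous.smul hφ.continuous_gradient).integrable_of_hasCompactSupport hcg.smul_left
  have i2 : Integrable (fun x => φ x • gradient v x) :=
    (hφ.smooth.continuous.smul hgv).integrable_of_hasCompactSupport hφ.compact.smul_right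
  have i3 : Integrable (fun x => v x • φ x) :=
    (hv.continuous.smul hφ.smooth.continuous).integrable_of_hasCompactSupport hφ.compact.smul_left
  -- Pairing with a fixed direction `e` reduces the vector identity to scalar integration by parts
  -- for the derivative along `e`.
  refine ext_inner_left ℝ fun e => ?_
  rw [inner_neg_right, ← integral_inner i1, ← integral_inner i2]
  have j1 := i1.const_inner (𝕜 := ℝ) e
  have j2 := i2.const_inner (𝕜 := ℝ) e
  simp only [inner_smul_right, inner_gradient_eq_fderiv] at j1 j2 ⊢
  simp only [mul_comm (φ _)] at j2 ⊢
  exact integral_mul_fderiv_eq_neg_fderiv_mul_of_integrable j2 j1 i3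
    (fun x _ => hv.differentiable (by simp) x) (fun x _ => hφ.smooth.differentiable (by simp) x)

theorem IsTest.hasWeakGrad {U : Set Plane} {φ : Plane → ℝ} (h : IsTest U φ) :
    HasWeakGrad U φ (gradient φ) :=
  hasWeakGrad_gradient h.smooth (h.memLp_gradient _)

theorem IsTest.memH10 {U : Set Plane} (hU : IsOpen U) {φ : Plane → ℝ} (h : IsTest U φ) :
    MemH10 U φ := by
  refine ⟨⟨h.memLp _, _, h.hasWeakGrad⟩, fun _ => φ, fun _ => h, by simp, ?_⟩
  have h1 : gradient φ - weakGrad U φ =ᵐ[volume.restrict U] 0 := by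
    filter_upwards [h.hasWeakGrad.weakGrad_ae_eq hU] with x hx
    simp [hx]
  simp [eLpNorm_congr_ae h1]

/-! ### Affine functions -/

/-- The constant gradient of an affine function. -/
def affineGradient (p : Plane →ᵃ[ℝ] ℝ) : Plane :=
  (InnerProductSpace.toDual ℝ Plane).symm (LinearMap.toContinuousLinearMap p.linear)

theorem inner_affineGradient (p : Plane →ᵃ[ℝ] ℝ) (y : Plane) :
    inner ℝ (affineGradient p) y = p.linear y := by
  simp [affineGradient]

theorem gradient_affineMap (p : Plane →ᵃ[ℝ] ℝ) : gradient p = fun _ => affineGradient p := by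
  funext x
  refine HasGradientAt.gradient ?_
  rw [hasGradientAt_iff_hasFDerivAt, affineGradient, LinearIsometryEquiv.apply_symm_apply]
  have h := (LinearMap.toContinuousLinearMap p.linear).hasFDerivAt (x := x) |>.add_const (p 0)
  refine h.congr_of_eventuallyEq (Eventually.of_forall fun y => ?_)
  have := p.linearMap_vsub y 0
  simp at this ⊢
  linarith

theorem affineGradient_sub (p q : Plane →ᵃ[ℝ] ℝ) :
    affineGradient (p - q) = affineGradient p - affineGradient q := by
  refine ext_inner_right ℝ fun y => ?_
  simp [inner_sub_left, inner_affineGradient]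

theorem affineMap_apply_eq (p : Plane →ᵃ[ℝ] ℝ) (x : Plane) :
    p x = inner ℝ (affineGradient p) x + p 0 := by
  have := p.linearMap_vsub x 0
  rw [inner_affineGradient]
  simp at this
  linarith

theorem contDiff_affineMap (p : Plane →ᵃ[ℝ] ℝ) : ContDiff ℝ ∞ p := by
  rw [funext (affineMap_apply_eq p)]
  exact (contDiff_const.inner ℝ contDiff_id).add contDiff_const

/-- The affine function with gradient `m` and value `c` at the origin. -/
def affineOfGradient (m : Plane) (c : ℝ) : Plane →ᵃ[ℝ] ℝ :=
  (innerₗ Plane m).toAffineMap + AffineMap.const ℝ Plane c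

theorem affineOfGradient_apply (m : Plane) (c : ℝ) (x : Plane) :
    affineOfGradient m c x = inner ℝ m x + c := by
  simp [affineOfGradient]

theorem affineGradient_affineOfGradient (m : Plane) (c : ℝ) :
    affineGradient (affineOfGradient m c) = m := by
  refine ext_inner_right ℝ fun y => ?_
  simp [inner_affineGradient, affineOfGradient]

theorem memLp_affineMap {U : Set Plane} (hb : Bornology.IsBounded U) (p : Plane →ᵃ[ℝ] ℝ) :
    MemLp p 2 (volume.restrict U) := by
  have : IsFiniteMeasure (volume.restrict U) := ⟨by simpa using hb.measure_lt_top⟩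
  have hp := (contDiff_affineMap p).continuous
  obtain ⟨C, hC⟩ := hb.isCompact_closure.exists_bound_of_continuousOn hp.continuousOn
  refine MemLp.of_bound hp.aestronglyMeasurable C ?_
  filter_upwards [ae_restrict_of_ae_restrict_of_subset subset_closure
    (ae_restrict_mem isClosed_closure.measurableSet)] with x hx using hC x hx

theorem hasWeakGrad_affineMap {U : Set Plane} (hb : Bornology.IsBounded U) (p : Plane →ᵃ[ℝ] ℝ) :
    HasWeakGrad U p (fun _ => affineGradient p) := by
  have : IsFiniteMeasure (volume.restrict U) := ⟨by simpa using hb.measure_lt_top⟩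
  rw [← gradient_affineMap p]
  refine hasWeakGrad_gradient (contDiff_affineMap p) ?_
  rw [gradient_affineMap]
  exact memLp_const _

theorem memH1_affineMap {U : Set Plane} (hb : Bornology.IsBounded U) (p : Plane →ᵃ[ℝ] ℝ) :
    MemH1 U p :=
  ⟨memLp_affineMap hb p, _, hasWeakGrad_affineMap hb p⟩

/-- Constant fields are divergence free: integrate by parts against the constant function 1. -/
theorem IsTest.integral_inner_const {U : Set Plane} {φ : Plane → ℝ} (h : IsTest U φ) (m : Plane) :
    ∫ x in U, inner ℝ m (gradient φ x) = 0 := by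
  rw [setIntegral_eq_integral_of_forall_compl_eq_zero
    (fun x hx => by rw [h.gradient_eq_zero hx, inner_zero_right])]
  have hi : Integrable (gradient φ) := by
    refine h.continuous_gradient.integrable_of_hasCompactSupport ?_
    exact (h.compact.fderiv ℝ).comp_left (g := (InnerProductSpace.toDual ℝ Plane).symm) (by simp)
  have hj := hi.const_inner (𝕜 := ℝ) m
  simp only [inner_gradient_eq_fderiv] at hj ⊢
  have := integral_mul_fderiv_eq_neg_fderiv_mul_of_integrable (μ := volume) (𝕜 := ℝ)
    (f := fun _ : Plane => (1 : ℝ)) (g := φ) (v := m) (by simp) (by simpa using hj)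
    (by simpa using h.smooth.continuous.integrable_of_hasCompactSupport h.compact)
    (fun x _ => by fun_prop) (fun x _ => h.smooth.differentiable (by simp) x)
  simpa using this

/-! ### Traces -/

theorem measure_inter_ball_ne_zero {U : Set Plane} (hU : IsOpen U) {x : Plane}
    (hx : x ∈ frontier U) {r : ℝ} (hr : 0 < r) : volume (U ∩ Metric.ball x r) ≠ 0 := by
  obtain ⟨y, hy, hyU⟩ := mem_closure_iff.1 hx.1 _ Metric.isOpen_ball (Metric.mem_ball_self hr)
  exact ((hU.inter Metric.isOpen_ball).measure_pos volume ⟨y, hyU, hy⟩).ne'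

theorem measure_inter_ball_ne_top (U : Set Plane) (x : Plane) (r : ℝ) :
    volume (U ∩ Metric.ball x r) ≠ ⊤ :=
  ((measure_mono Set.inter_subset_right).trans_lt measure_ball_lt_top).ne

theorem setAverage_abs_nonneg (s : Set Plane) (h : Plane → ℝ) : 0 ≤ ⨍ y in s, |h y| := by
  rw [setAverage_eq]
  exact smul_nonneg (by positivity) (integral_nonneg fun _ => abs_nonneg _)

theorem HasTrace.sub {U : Set Plane} {v w g h : Plane → ℝ}
    (hv : IntegrableOn v U) (hw : IntegrableOn w U)
    (hg : HasTrace U v g) (hh : HasTrace U w h) : HasTrace U (v - w) (g - h) := by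
  filter_upwards [hg, hh] with x h1 h2
  have h3 := h1.add h2
  rw [add_zero] at h3
  refine tendsto_of_tendsto_of_tendsto_of_le_of_le tendsto_const_nhds h3
    (fun r => setAverage_abs_nonneg _ _) fun r => ?_
  have hs := measure_inter_ball_ne_top U x r
  have i1 : IntegrableOn (fun y => |v y - g x|) (U ∩ Metric.ball x r) :=
    ((hv.mono_set Set.inter_subset_left).sub (integrableOn_const hs)).abs
  have i2 : IntegrableOn (fun y => |w y - h x|) (U ∩ Metric.ball x r) :=
    ((hw.mono_set Set.inter_subset_left).sub (integrableOn_const hs)).abs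
  have i3 : IntegrableOn (fun y => |(v - w) y - (g - h) x|) (U ∩ Metric.ball x r) :=
    (((hv.sub hw).mono_set Set.inter_subset_left).sub (integrableOn_const hs)).abs
  simp only [setAverage_eq, ← smul_add]
  rw [← integral_add i1 i2]
  refine smul_le_smul_of_nonneg_left (integral_mono i3 (i1.add i2) fun y => ?_) (by positivity)
  have : (v - w) y - (g - h) x = (v y - g x) - (w y - h x) := by
    simp only [Pi.sub_apply]
    ring
  dsimp only
  rw [this]
  exact abs_sub _ _

/-- By subtraction, `g - g'` is a trace of zero, so the averages are the constant `|g x - g' x|` and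
tend to 0. Openness of `U` gives the sets averaged over positive measure; otherwise the average
would take the default value 0. -/
theorem HasTrace.unique {U : Set Plane} (hU : IsOpen U) {v g g' : Plane → ℝ}
    (hv : IntegrableOn v U) (hg : HasTrace U v g) (hg' : HasTrace U v g') :
    g =ᵐ[arcLength U] g' := by
  have hm : ∀ᵐ x ∂(arcLength U), x ∈ frontier U := ae_restrict_mem isClosed_frontier.measurableSet
  filter_upwards [hg.sub hv hv hg', hm] with x hx hxU
  have h1 : (fun r : ℝ => ⨍ y in U ∩ Metric.ball x r, |(v - v) y - (g - g') x|)
      =ᶠ[𝓝[>] 0] fun _ => |(g - g') x| := by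
    filter_upwards [self_mem_nhdsWithin] with r hr
    simp only [sub_self, Pi.zero_apply, zero_sub, abs_neg]
    exact setAverage_const (measure_inter_ball_ne_zero hU hxU hr)
      (measure_inter_ball_ne_top U x r) _
  have h2 := tendsto_nhds_unique (hx.congr' h1) tendsto_const_nhds
  exact sub_eq_zero.1 (abs_eq_zero.1 h2.symm)

theorem hasTrace_of_continuousOn {U : Set Plane} {v : Plane → ℝ}
    (hv : ContinuousOn v (closure U)) : HasTrace U v v := by
  have hm : ∀ᵐ x ∂(arcLength U), x ∈ frontier U := ae_restrict_mem isClosed_frontier.measurableSet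
  filter_upwards [hm] with x hx
  rw [Metric.tendsto_nhdsWithin_nhds]
  intro ε hε
  obtain ⟨δ, hδ, h⟩ := Metric.continuousOn_iff.1 hv x hx.1 (ε / 2) (half_pos hε)
  refine ⟨δ, hδ, fun {r} hr hrδ => ?_⟩
  have hrδ' : r < δ := by
    rw [Real.dist_eq, sub_zero] at hrδ
    exact (le_abs_self r).trans_lt hrδ
  rw [Real.dist_eq, sub_zero, abs_of_nonneg (setAverage_abs_nonneg _ _), setAverage_eq, smul_eq_mul]
  have h1 : ‖∫ y in U ∩ Metric.ball x r, |v y - v x|‖ ≤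
      ε / 2 * volume.real (U ∩ Metric.ball x r) := by
    refine norm_setIntegral_le_of_norm_le_const
      (measure_inter_ball_ne_top U x r).lt_top fun y hy => ?_
    rw [Real.norm_eq_abs, abs_abs, ← Real.dist_eq]
    exact (h y (subset_closure hy.1) ((Metric.mem_ball.1 hy.2).trans hrδ')).le
  refine lt_of_le_of_lt ?_ (half_lt_self hε)
  calc (volume.real (U ∩ Metric.ball x r))⁻¹ * ∫ y in U ∩ Metric.ball x r, |v y - v x|
      ≤ (volume.real (U ∩ Metric.ball x r))⁻¹ * (ε / 2 * volume.real (U ∩ Metric.ball x r)) :=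
        mul_le_mul_of_nonneg_left ((le_abs_self _).trans h1) (by positivity)
    _ = ε / 2 * ((volume.real (U ∩ Metric.ball x r))⁻¹ * volume.real (U ∩ Metric.ball x r)) := by
        ring
    -- Only `≤ 1` is needed, so a set of measure zero causes no trouble.
    _ ≤ ε / 2 * 1 := mul_le_mul_of_nonneg_left inv_mul_le_one (half_pos hε).le
    _ = ε / 2 := mul_one _

/-! ### Geometry of polygons -/

theorem volume_segment (a b : Plane) : volume (segment ℝ a b) = 0 := by
  have h : line[ℝ, a, b] ≠ ⊤ := by
    intro h
    have h1 := (collinear_pair ℝ a b).finrank_le_one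
    rw [← direction_affineSpan, h, AffineSubspace.direction_top, finrank_top] at h1
    simp at h1
  refine measure_mono_null ?_ (Measure.addHaar_affineSubspace volume _ h)
  rw [← convexHull_pair]
  exact convexHull_subset_affineSpan _

namespace SimplePolygon

variable (K : SimplePolygon)

theorem volume_frontier : volume (frontier K.carrier) = 0 := by
  rw [K.frontier_eq]
  exact measure_iUnion_null fun i => volume_segment _ _

theorem frontier_isCompact : IsCompact (frontier K.carrier) :=
  K.isBounded.isCompact_closure.of_isClosed_subset isClosed_frontier frontier_subset_closure

instance isFiniteMeasure_arcLength : IsFiniteMeasure (arcLength K.carrier) := by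
  refine ⟨?_⟩
  rw [arcLength, Measure.restrict_apply_univ, K.frontier_eq]
  refine (measure_iUnion_fintype_le _ _).trans_lt (ENNReal.sum_lt_top.2 fun i _ => ?_)
  rw [hausdorffMeasure_segment]
  exact edist_lt_top _ _

theorem vertex_ne_next (i : Fin K.n) : K.vertex i ≠ K.vertex (finRotate K.n i) := by
  intro h
  -- A degenerate edge would take the same value at the parameters 0 and 1/2.
  have h1 := K.simple i i 0 (by simp) 2⁻¹ (by constructor <;> norm_num)
    (by rw [← h]; simp)
  norm_num at h1

theorem arcLength_real_pos : 0 < (arcLength K.carrier).real Set.univ := by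
  rw [measureReal_def, ENNReal.toReal_pos_iff]
  refine ⟨?_, measure_lt_top _ _⟩
  rw [arcLength, Measure.restrict_apply_univ, K.frontier_eq]
  have i : Fin K.n := ⟨0, by have := K.three_le; omega⟩
  refine lt_of_lt_of_le ?_ (measure_mono (Set.subset_iUnion _ i))
  rw [hausdorffMeasure_segment, edist_pos]
  exact K.vertex_ne_next i

/-- An empty set has empty frontier, whereas the boundary has positive length. -/
theorem carrier_nonempty : K.carrier.Nonempty := by
  rw [Set.nonempty_iff_ne_empty]
  intro h
  have h1 := K.arcLength_real_pos
  rw [arcLength, h] at h1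
  simp at h1

theorem volume_real_pos : 0 < volume.real K.carrier := by
  rw [measureReal_def, ENNReal.toReal_pos_iff]
  exact ⟨K.isOpen.measure_pos volume K.carrier_nonempty, K.isBounded.measure_lt_top⟩

instance isFiniteMeasure_restrict : IsFiniteMeasure (volume.restrict K.carrier) :=
  ⟨by simpa using K.isBounded.measure_lt_top⟩

theorem integrable_arcLength {g : Plane → ℝ} (hg : ContinuousOn g (frontier K.carrier)) :
    Integrable g (arcLength K.carrier) := by
  obtain ⟨C, hC⟩ := K.frontier_isCompact.exists_bound_of_continuousOn hg
  refine Integrable.of_bound (hg.aestronglyMeasurable isClosed_frontier.measurableSet) C ?_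
  filter_upwards [ae_restrict_mem isClosed_frontier.measurableSet] with x hx using hC x hx

end SimplePolygon

/-! ### The projection onto affine functions -/

/-- `v ∈ H¹(K)` has a trace that is integrable along `∂K`. -/
def HasIntegrableTrace (K : SimplePolygon) (v : Plane → ℝ) : Prop :=
  MemH1 K.carrier v ∧ ∃ g, HasTrace K.carrier v g ∧ Integrable g (arcLength K.carrier)

section Projection

variable {K : SimplePolygon} {v w : Plane → ℝ}

theorem MemH1.integrableOn (h : MemH1 K.carrier v) : IntegrableOn v K.carrier :=
  h.1.integrable (by norm_num)

theorem HasIntegrableTrace.sub (hv : HasIntegrableTrace K v) (hw : HasIntegrableTrace K w) :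
    HasIntegrableTrace K (v - w) := by
  obtain ⟨hv1, g, hg, hgi⟩ := hv
  obtain ⟨hw1, h, hh, hhi⟩ := hw
  exact ⟨hv1.sub hw1, _, hg.sub hv1.integrableOn hw1.integrableOn hh, hgi.sub hhi⟩

theorem hasTrace_affineMap (p : Plane →ᵃ[ℝ] ℝ) : HasTrace K.carrier p p :=
  hasTrace_of_continuousOn (contDiff_affineMap p).continuous.continuousOn

theorem integrable_arcLength_affineMap (p : Plane →ᵃ[ℝ] ℝ) :
    Integrable p (arcLength K.carrier) :=
  K.integrable_arcLength (contDiff_affineMap p).continuous.continuousOn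

theorem integral_arcLength_affineMap (p : Plane →ᵃ[ℝ] ℝ) :
    ∫ x, p x ∂(arcLength K.carrier) =
      ∫ x, inner ℝ (affineGradient p) x ∂(arcLength K.carrier) +
        (arcLength K.carrier).real Set.univ • p 0 := by
  rw [integral_congr_ae (Eventually.of_forall (affineMap_apply_eq p)),
    integral_add (K.integrable_arcLength (by fun_prop)) (integrable_const _), integral_const]

theorem hasIntegrableTrace_of_continuousOn (hv : MemH1 K.carrier v)
    (hc : ContinuousOn v (closure K.carrier)) : HasIntegrableTrace K v :=
  ⟨hv, v, hasTrace_of_continuousOn hc, K.integrable_arcLength (hc.mono frontier_subset_closure)⟩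

theorem hasIntegrableTrace_of_mem_VK (hv : v ∈ VK K) : HasIntegrableTrace K v := by
  obtain ⟨h1, ⟨g, hg, hB⟩, -⟩ := hv
  exact ⟨h1, g, hg, K.integrable_arcLength hB.1⟩

theorem MemH1.integrable_weakGrad (h : MemH1 K.carrier v) :
    Integrable (weakGrad K.carrier v) (volume.restrict K.carrier) :=
  h.hasWeakGrad.1.integrable (by norm_num)

/-- Gradients of affine functions are exactly the constant vectors, so orthogonality to them fixes
the mean gradient. Uniqueness of traces allows any trace `g` to replace the existential one. -/
theorem isProj_iff_of_hasTrace (hv : MemH1 K.carrier v) {g : Plane → ℝ}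
    (hg : HasTrace K.carrier v g) (hgi : Integrable g (arcLength K.carrier))
    (p : Plane →ᵃ[ℝ] ℝ) :
    IsProj K v p ↔
      volume.real K.carrier • affineGradient p = ∫ x in K.carrier, weakGrad K.carrier v x ∧
        ∫ x, p x ∂(arcLength K.carrier) = ∫ x, g x ∂(arcLength K.carrier) := by
  have hi := hv.integrable_weakGrad
  have hip : Integrable (fun _ : Plane => affineGradient p) (volume.restrict K.carrier) :=
    integrable_const _
  have hip' := integrable_arcLength_affineMap (K := K) p
  have hs : ∀ m : Plane,
      ∫ x in K.carrier, inner ℝ (weakGrad K.carrier v x - affineGradient p) m =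
        inner ℝ m ((∫ x in K.carrier, weakGrad K.carrier v x) -
          volume.real K.carrier • affineGradient p) := by
    intro m
    have h1 := integral_inner (𝕜 := ℝ) (hi.sub hip) m
    simp only [Pi.sub_apply] at h1
    rw [integral_sub hi hip, setIntegral_const] at h1
    rw [← h1]
    simp only [real_inner_comm]
  simp only [IsProj, gradient_affineMap, hs]
  refine and_congr ⟨fun h => ?_, fun h q => ?_⟩ ⟨?_, fun h => ?_⟩
  · refine (sub_eq_zero.1 (ext_inner_left ℝ fun m => ?_)).symm
    rw [inner_zero_right, ← affineGradient_affineOfGradient m 0]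
    exact h _
  · rw [h, sub_self, inner_zero_right]
  · rintro ⟨g', hg', hgi', h0⟩
    rw [integral_sub hgi' hip', sub_eq_zero] at h0
    rw [← h0]
    exact integral_congr_ae (hg'.unique K.isOpen hv.integrableOn hg)
  · exact ⟨g, hg, hgi, by rw [integral_sub hgi hip', h, sub_self]⟩

theorem exists_isProj (hv : HasIntegrableTrace K v) : ∃ p, IsProj K v p := by
  obtain ⟨h1, g, hg, hgi⟩ := hv
  have hV := K.volume_real_pos
  have hA := K.arcLength_real_pos
  -- `m` is the mean gradient; `c` then solves the boundary condition, which is solvable because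
  -- `∂K` has positive length.
  set m : Plane := (volume.real K.carrier)⁻¹ • ∫ x in K.carrier, weakGrad K.carrier v x with hm
  set c : ℝ := ((arcLength K.carrier).real Set.univ)⁻¹ *
    (∫ x, g x ∂(arcLength K.carrier) - ∫ x, inner ℝ m x ∂(arcLength K.carrier)) with hc
  refine ⟨affineOfGradient m c, (isProj_iff_of_hasTrace h1 hg hgi _).2 ⟨?_, ?_⟩⟩
  · rw [affineGradient_affineOfGradient, hm, smul_smul, mul_inv_cancel₀ hV.ne', one_smul]
  · simp only [affineOfGradient_apply]
    rw [integral_add (K.integrable_arcLength (by fun_prop)) (integrable_const _), integral_const,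
      smul_eq_mul, hc, mul_inv_cancel_left₀ hA.ne']
    ring

theorem IsProj.unique (hv : MemH1 K.carrier v) {p q : Plane →ᵃ[ℝ] ℝ} (hp : IsProj K v p)
    (hq : IsProj K v q) : p = q := by
  obtain ⟨g, hg, hgi, -⟩ := hp.2
  rw [isProj_iff_of_hasTrace hv hg hgi] at hp hq
  have hG : affineGradient p = affineGradient q :=
    smul_right_injective _ K.volume_real_pos.ne' (hp.1.trans hq.1.symm)
  have hpq := hp.2.trans hq.2.symm
  rw [integral_arcLength_affineMap, integral_arcLength_affineMap, hG] at hpq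
  ext x
  rw [affineMap_apply_eq p, affineMap_apply_eq q, hG,
    smul_right_injective ℝ K.arcLength_real_pos.ne' (add_left_cancel hpq)]

theorem isProj_proj (hv : HasIntegrableTrace K v) : IsProj K v (proj K v) := by
  have h := exists_isProj hv
  rw [proj, dif_pos h]
  exact h.choose_spec

theorem proj_sub (hv : HasIntegrableTrace K v) (hw : HasIntegrableTrace K w) :
    proj K (v - w) = proj K v - proj K w := by
  have h1 := isProj_proj hv
  have h2 := isProj_proj hw
  refine (isProj_proj (hv.sub hw)).unique (hv.1.sub hw.1) ?_
  obtain ⟨hv1, g, hg, hgi⟩ := hv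
  obtain ⟨hw1, h, hh, hhi⟩ := hw
  rw [isProj_iff_of_hasTrace hv1 hg hgi] at h1
  rw [isProj_iff_of_hasTrace hw1 hh hhi] at h2
  rw [isProj_iff_of_hasTrace (hv1.sub hw1) (hg.sub hv1.integrableOn hw1.integrableOn hh)
    (hgi.sub hhi)]
  constructor
  · rw [affineGradient_sub, smul_sub, h1.1, h2.1, integral_congr_ae (hv1.weakGrad_sub K.isOpen hw1)]
    exact (integral_sub hv1.integrable_weakGrad hw1.integrable_weakGrad).symm
  · simp only [AffineMap.coe_sub, Pi.sub_apply]
    rw [integral_sub (integrable_arcLength_affineMap _) (integrable_arcLength_affineMap _), h1.2,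
      h2.2, integral_sub hgi hhi]

/-- The defining orthogonality of `Π`, used to replace `∇v` by `∇Πv` against constant fields. -/
theorem integral_inner_weakGrad_const (hv : HasIntegrableTrace K v) (m : Plane) :
    ∫ x in K.carrier, inner ℝ m (weakGrad K.carrier v x) =
      ∫ _ in K.carrier, inner ℝ m (affineGradient (proj K v)) := by
  have h1 := isProj_proj hv
  obtain ⟨hv1, g, hg, hgi⟩ := hv
  rw [isProj_iff_of_hasTrace hv1 hg hgi] at h1
  rw [integral_inner hv1.integrable_weakGrad, ← h1.1, inner_smul_right, setIntegral_const,
    smul_eq_mul]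

end Projection

/-! ### The local spaces and the discrete form -/

section Local

variable {K : SimplePolygon} {v w : Plane → ℝ}

theorem MemB1.sub {g h : Plane → ℝ} (hg : MemB1 K g) (hh : MemB1 K h) : MemB1 K (g - h) := by
  refine ⟨hg.1.sub hh.1, fun i => ?_⟩
  obtain ⟨p, hp⟩ := hg.2 i
  obtain ⟨q, hq⟩ := hh.2 i
  exact ⟨p - q, fun x hx => by simp [hp x hx, hq x hx]⟩

theorem sub_mem_VK (hv : v ∈ VK K) (hw : w ∈ VK K) : v - w ∈ VK K := by
  obtain ⟨hv1, ⟨g, hg, hgB⟩, hv2⟩ := hv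
  obtain ⟨hw1, ⟨h, hh, hhB⟩, hw2⟩ := hw
  refine ⟨hv1.sub hw1, ⟨g - h, hg.sub hv1.integrableOn hw1.integrableOn hh, hgB.sub hhB⟩,
    fun φ hφ => ?_⟩
  have h1 : (fun x => inner ℝ (weakGrad K.carrier (v - w) x) (gradient φ x))
      =ᵐ[volume.restrict K.carrier] fun x => inner ℝ (weakGrad K.carrier v x) (gradient φ x) -
        inner ℝ (weakGrad K.carrier w x) (gradient φ x) := by
    filter_upwards [hv1.weakGrad_sub K.isOpen hw1] with x hx
    rw [hx, Pi.sub_apply, inner_sub_left]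
  rw [integral_congr_ae h1, integral_sub
    (MemLp.integrable_inner_of_two hv1.hasWeakGrad.1 (hφ.memLp_gradient _))
    (MemLp.integrable_inner_of_two hw1.hasWeakGrad.1 (hφ.memLp_gradient _)), hv2 φ hφ, hw2 φ hφ,
    sub_self]

theorem affineMap_mem_VK (p : Plane →ᵃ[ℝ] ℝ) : (p : Plane → ℝ) ∈ VK K := by
  refine ⟨memH1_affineMap K.isBounded p, ⟨p, hasTrace_affineMap p,
    (contDiff_affineMap p).continuous.continuousOn, fun _ => ⟨p, fun _ _ => rfl⟩⟩, fun φ hφ => ?_⟩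
  rw [← hφ.integral_inner_const (affineGradient p)]
  refine integral_congr_ae ?_
  filter_upwards [(hasWeakGrad_affineMap K.isBounded p).weakGrad_ae_eq K.isOpen] with x hx
  rw [hx]

theorem slice_eq_sub (K : SimplePolygon) (v : Plane → ℝ) : slice K v = v - ⇑(proj K v) := rfl

theorem slice_mem_VK (hv : v ∈ VK K) : slice K v ∈ VK K :=
  sub_mem_VK hv (affineMap_mem_VK _)

theorem slice_sub (hv : HasIntegrableTrace K v) (hw : HasIntegrableTrace K w) :
    slice K (v - w) = slice K v - slice K w := by
  simp only [slice_eq_sub, proj_sub hv hw, AffineMap.coe_sub]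
  abel

theorem weakGrad_slice_ae_eq (hv : MemH1 K.carrier v) :
    weakGrad K.carrier (slice K v) =ᵐ[volume.restrict K.carrier]
      fun x => weakGrad K.carrier v x - affineGradient (proj K v) := by
  filter_upwards [hv.weakGrad_sub K.isOpen (memH1_affineMap K.isBounded (proj K v)),
    (hasWeakGrad_affineMap K.isBounded (proj K v)).weakGrad_ae_eq K.isOpen] with x h1 h2
  rw [slice_eq_sub, h1, Pi.sub_apply, h2]

theorem gradIP_sub_left (p q r : Plane →ᵃ[ℝ] ℝ) :
    gradIP K (p - q) r = gradIP K p r - gradIP K q r := by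
  simp only [gradIP, gradient_affineMap, affineGradient_sub, inner_sub_left, setIntegral_const,
    smul_sub]

/-- Additivity applied to `a = (a - b) + b`; `V` is a bare set, so membership of `a - b` has to be
supplied. -/
theorem IsBilinearOn.sub_left {V : Set (Plane → ℝ)} {S : (Plane → ℝ) → (Plane → ℝ) → ℝ}
    (hS : IsBilinearOn V S) {a b c : Plane → ℝ} (hab : a - b ∈ V) (hb : b ∈ V) (hc : c ∈ V) :
    S (a - b) c = S a c - S b c := by
  have h := hS.add_left _ hab _ hb _ hc
  rw [sub_add_cancel] at h
  linarith

end Local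

theorem ah_sub_left {ι : Type*} [Fintype ι] {K : ι → SimplePolygon}
    {S : ι → (Plane → ℝ) → (Plane → ℝ) → ℝ} (hS : ∀ i, IsBilinearOn (VK (K i)) (S i))
    {w w' v : Plane → ℝ} (hw : ∀ i, w ∈ VK (K i)) (hw' : ∀ i, w' ∈ VK (K i))
    (hv : ∀ i, v ∈ VK (K i)) : ah K S (w - w') v = ah K S w v - ah K S w' v := by
  have h1 : ∀ i, gradIP (K i) (proj (K i) (w - w')) (proj (K i) v) =
      gradIP (K i) (proj (K i) w) (proj (K i) v) - gradIP (K i) (proj (K i) w') (proj (K i) v) :=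
    fun i => by
      rw [proj_sub (hasIntegrableTrace_of_mem_VK (hw i)) (hasIntegrableTrace_of_mem_VK (hw' i)),
        gradIP_sub_left]
  have h2 : ∀ i, S i (slice (K i) (w - w')) (slice (K i) v) =
      S i (slice (K i) w) (slice (K i) v) - S i (slice (K i) w') (slice (K i) v) := fun i => by
    rw [slice_sub (hasIntegrableTrace_of_mem_VK (hw i)) (hasIntegrableTrace_of_mem_VK (hw' i))]
    exact (hS i).sub_left (sub_mem_VK (slice_mem_VK (hw i)) (slice_mem_VK (hw' i)))
      (slice_mem_VK (hw' i)) (slice_mem_VK (hv i))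
  simp only [ah, h1, h2, Finset.sum_sub_distrib]
  ring

/-! ### The boundary pairing of the weak solution -/

section Pairing

variable {Ω : Set Plane} {K : SimplePolygon} {f u v : Plane → ℝ}

theorem weakGrad_ae_eq_of_subset (hK : K.carrier ⊆ Ω) (hv : MemH1 Ω v) :
    weakGrad K.carrier v =ᵐ[volume.restrict K.carrier] weakGrad Ω v :=
  (hv.hasWeakGrad.mono hK).weakGrad_ae_eq K.isOpen

theorem IsWeakSolution.integral_inner_gradient (hΩ : IsOpen Ω) (hu : IsWeakSolution Ω f u)
    {φ : Plane → ℝ} (hφ : IsTest Ω φ) :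
    ∫ x in Ω, inner ℝ (weakGrad Ω u x) (gradient φ x) = ∫ x in Ω, f x * φ x := by
  rw [← hu.2 φ (hφ.memH10 hΩ)]
  refine integral_congr_ae ?_
  filter_upwards [hφ.hasWeakGrad.weakGrad_ae_eq hΩ] with x hx
  rw [hx]

/-- Test functions on `K` extend by zero to admissible ones on `Ω`, which gives `Δu = -f` in `K`;
the constant `∇Πu` contributes no divergence. -/
theorem IsWeakSolution.hasWeakDiv_slice (hΩ : IsOpen Ω) (hu : IsWeakSolution Ω f u)
    (hf : MemLp f 2 (volume.restrict Ω)) (hK : K.carrier ⊆ Ω) :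
    HasWeakDiv K.carrier (weakGrad K.carrier (slice K u)) (-f) := by
  have hu1 := hu.1.1
  have huK := hu1.mono hK
  refine ⟨(hf.mono_measure (Measure.restrict_mono_set _ hK)).neg, fun φ hφ => ?_⟩
  have hc : IntegrableOn (fun x => inner ℝ (affineGradient (proj K u)) (gradient φ x)) K.carrier :=
    MemLp.integrable_inner_of_two (memLp_const _) (hφ.memLp_gradient _)
  have h1 : (fun x => inner ℝ (weakGrad K.carrier (slice K u) x) (gradient φ x))
      =ᵐ[volume.restrict K.carrier] fun x => inner ℝ (weakGrad Ω u x) (gradient φ x) -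
        inner ℝ (affineGradient (proj K u)) (gradient φ x) := by
    filter_upwards [weakGrad_slice_ae_eq huK, weakGrad_ae_eq_of_subset hK hu1] with x h2 h3
    rw [h2, h3, inner_sub_left]
  have h4 := hu.integral_inner_gradient hΩ (hφ.mono hK)
  rw [setIntegral_eq_integral_of_forall_compl_eq_zero
      (fun x hx => by rw [(hφ.mono hK).gradient_eq_zero hx, inner_zero_right]),
    setIntegral_eq_integral_of_forall_compl_eq_zero
      (fun x hx => by rw [(hφ.mono hK).eq_zero hx, mul_zero]),
    ← setIntegral_eq_integral_of_forall_compl_eq_zero (s := K.carrier)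
      (fun x hx => by rw [hφ.gradient_eq_zero hx, inner_zero_right]),
    ← setIntegral_eq_integral_of_forall_compl_eq_zero (s := K.carrier) (f := fun x => f x * φ x)
      (fun x hx => by rw [hφ.eq_zero hx, mul_zero])] at h4
  rw [integral_congr_ae h1, integral_sub (MemLp.integrable_inner_of_two
    (hu1.hasWeakGrad.mono hK).1 (hφ.memLp_gradient _)) hc, hφ.integral_inner_const, sub_zero, h4,
    ← integral_neg]
  simp

/-- Orthogonality of `Π` makes each mixed term `(∇Πu, ∇v)_K`, `(∇Πv, ∇u)_K` equal to `(∇Πu, ∇Πv)_K`,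
so one of three copies survives, with a minus sign. -/
theorem integral_inner_weakGrad_slice (hu : HasIntegrableTrace K u) (hv : HasIntegrableTrace K v) :
    ∫ x in K.carrier, inner ℝ (weakGrad K.carrier (slice K u) x)
        (weakGrad K.carrier (slice K v) x) =
      (∫ x in K.carrier, inner ℝ (weakGrad K.carrier u x) (weakGrad K.carrier v x)) -
        gradIP K (proj K u) (proj K v) := by
  have hGu := hu.1.hasWeakGrad.1
  have hGv := hv.1.hasWeakGrad.1
  have hc : ∀ m : Plane, MemLp (fun _ : Plane => m) 2 (volume.restrict K.carrier) :=
    fun m => memLp_const m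
  have h1 : (fun x => inner ℝ (weakGrad K.carrier (slice K u) x)
        (weakGrad K.carrier (slice K v) x))
      =ᵐ[volume.restrict K.carrier] fun x =>
        (inner ℝ (weakGrad K.carrier u x) (weakGrad K.carrier v x) -
          inner ℝ (affineGradient (proj K u)) (weakGrad K.carrier v x)) -
        (inner ℝ (affineGradient (proj K v)) (weakGrad K.carrier u x) -
          inner ℝ (affineGradient (proj K v)) (affineGradient (proj K u))) := by
    filter_upwards [weakGrad_slice_ae_eq hu.1, weakGrad_slice_ae_eq hv.1] with x h2 h3
    rw [h2, h3, inner_sub_left, inner_sub_right, inner_sub_right,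
      real_inner_comm (affineGradient (proj K v)) (weakGrad K.carrier u x),
      real_inner_comm (affineGradient (proj K v)) (affineGradient (proj K u))]
    ring
  have i1 := MemLp.integrable_inner_of_two hGu hGv
  have i2 := MemLp.integrable_inner_of_two (hc (affineGradient (proj K u))) hGv
  have i3 := MemLp.integrable_inner_of_two (hc (affineGradient (proj K v))) hGu
  have i4 : Integrable (fun _ => inner ℝ (affineGradient (proj K v)) (affineGradient (proj K u)))
      (volume.restrict K.carrier) := integrable_const _
  rw [integral_congr_ae h1, integral_sub (by exact i1.sub i2) (by exact i3.sub i4),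
    integral_sub i1 i2, integral_sub i3 i4, integral_inner_weakGrad_const hu,
    integral_inner_weakGrad_const hv, sub_self, sub_zero]
  simp only [gradIP, gradient_affineMap]

theorem IsWeakSolution.normalPairing_slice (hΩ : IsOpen Ω) (hu : IsWeakSolution Ω f u)
    (hf : MemLp f 2 (volume.restrict Ω)) (hK : K.carrier ⊆ Ω) (huK : HasIntegrableTrace K u)
    (hvK : HasIntegrableTrace K v) (hv : MemH1 Ω v) :
    normalPairing K.carrier (weakGrad K.carrier (slice K u)) (slice K v) =
      (∫ x in K.carrier, inner ℝ (weakGrad Ω u x) (weakGrad Ω v x)) -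
        gradIP K (proj K u) (proj K v) -
      ((∫ x in K.carrier, f x * v x) - ∫ x in K.carrier, f x * proj K v x) := by
  have hfK := hf.mono_measure (Measure.restrict_mono_set volume hK)
  have h1 : ∫ x in K.carrier, inner ℝ (weakGrad K.carrier u x) (weakGrad K.carrier v x) =
      ∫ x in K.carrier, inner ℝ (weakGrad Ω u x) (weakGrad Ω v x) := by
    refine integral_congr_ae ?_
    filter_upwards [weakGrad_ae_eq_of_subset hK hu.1.1, weakGrad_ae_eq_of_subset hK hv] with x h2 h3
    rw [h2, h3]
  have hd := hu.hasWeakDiv_slice hΩ hf hK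
  have h4 : (fun x => weakDiv K.carrier (weakGrad K.carrier (slice K u)) x * slice K v x)
      =ᵐ[volume.restrict K.carrier] fun x => -(f x * v x - f x * proj K v x) := by
    filter_upwards [(hasWeakDiv_weakDiv ⟨_, hd⟩).unique K.isOpen hd] with x hx
    rw [hx, slice, Pi.neg_apply]
    ring
  rw [normalPairing, integral_inner_weakGrad_slice huK hvK, h1, integral_congr_ae h4, integral_neg,
    integral_sub (MemLp.integrable_mul_of_two hfK hvK.1.1)
      (MemLp.integrable_mul_of_two hfK (memLp_affineMap K.isBounded _)), ← sub_eq_add_neg]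

end Pairing

/-! ### Integration over a mesh -/

theorem IsMesh.sum_setIntegral {ι : Type*} [Fintype ι] {Ω : Set Plane} {K : ι → SimplePolygon}
    (hK : IsMesh Ω K) {h : Plane → ℝ} (hh : IntegrableOn h Ω) :
    ∑ i, ∫ x in (K i).carrier, h x = ∫ x in Ω, h x := by
  rw [← integral_iUnion_fintype (fun i => (K i).isOpen.measurableSet)
    (fun i j hij => hK.disjoint i j hij) fun i => hh.mono_set (hK.subset i)]
  refine setIntegral_congr_set ?_
  have h0 : volume (⋃ i, frontier (K i).carrier) = 0 :=
    measure_iUnion_null fun i => (K i).volume_frontier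
  -- A point of `Ω` in no open polygon lies in the closure of one, hence on its frontier, which is
  -- null.
  refine (LE.le.eventuallyLE (Set.iUnion_subset hK.subset)).antisymm ?_
  refine ae_le_set.2 (measure_mono_null ?_ h0)
  rintro x ⟨hx, hx'⟩
  have h1 : x ∈ closure Ω := subset_closure hx
  rw [hK.cover] at h1
  obtain ⟨i, hi⟩ := Set.mem_iUnion.1 h1
  refine Set.mem_iUnion.2 ⟨i, hi, fun h2 => hx' (Set.mem_iUnion.2 ⟨i, interior_subset h2⟩)⟩

end VEM

end

/-! ### The error identity -/

theorem theorem2p3 {ι : Type*} [Fintype ι] (Ω : Set VEM.Plane) (hΩ : IsOpen Ω)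
    (K : ι → VEM.SimplePolygon) (hK : VEM.IsMesh Ω K)
    (f : VEM.Plane → ℝ) (hf : MemLp f 2 (volume.restrict Ω))
    (u : VEM.Plane → ℝ) (hu : VEM.IsWeakSolution Ω f u) (hcont : ContinuousOn u (closure Ω))
    (S : ι → (VEM.Plane → ℝ) → (VEM.Plane → ℝ) → ℝ)
    (hS : ∀ i, VEM.IsBilinearOn (VEM.VK (K i)) (S i))
    (uh : VEM.Plane → ℝ) (huh : VEM.IsVEMSolution Ω K S f uh)
    (uI : VEM.Plane → ℝ) (huI : VEM.IsNodalInterpolant Ω K u uI)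
    (vh : VEM.Plane → ℝ) (hvh : vh ∈ VEM.Vh Ω K) :
    VEM.ah K S (uh - uI) vh =
      ∑ i, VEM.gradIP (K i) (VEM.proj (K i) (u - uI)) (VEM.proj (K i) vh)
      - ∑ i, S i (VEM.slice (K i) uI) (VEM.slice (K i) vh)
      + ∑ i, VEM.normalPairing (K i).carrier
          (VEM.weakGrad (K i).carrier (VEM.slice (K i) u)) (VEM.slice (K i) vh) := by
  have hKΩ := hK.subset
  have hu1 := hu.1.1
  have hv1 := hvh.1.1
  have huK : ∀ i, VEM.HasIntegrableTrace (K i) u := fun i =>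
    VEM.hasIntegrableTrace_of_continuousOn (hu1.mono (hKΩ i))
      (hcont.mono (closure_mono (hKΩ i)))
  have huIK : ∀ i, VEM.HasIntegrableTrace (K i) uI := fun i =>
    VEM.hasIntegrableTrace_of_mem_VK (huI.1.2 i)
  have hvK : ∀ i, VEM.HasIntegrableTrace (K i) vh := fun i =>
    VEM.hasIntegrableTrace_of_mem_VK (hvh.2 i)
  -- The weak equation tested with `vh`, which is admissible since `V_h ⊆ H¹₀(Ω)`, split over the
  -- mesh.
  have hconsistent : (∑ i, ∫ x in (K i).carrier,
        inner ℝ (VEM.weakGrad Ω u x) (VEM.weakGrad Ω vh x)) =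
      ∑ i, ∫ x in (K i).carrier, f x * vh x := by
    rw [hK.sum_setIntegral (VEM.MemLp.integrable_inner_of_two hu1.hasWeakGrad.1 hv1.hasWeakGrad.1),
      hK.sum_setIntegral (VEM.MemLp.integrable_mul_of_two hf hv1.1), hu.2 vh hvh.1]
  have hpair := fun i => hu.normalPairing_slice hΩ hf (hKΩ i) (huK i) (hvK i) hv1
  have hproj := fun i => VEM.proj_sub (huK i) (huIK i)
  rw [VEM.ah_sub_left hS huh.1.2 huI.1.2 hvh.2, huh.2 vh hvh]
  simp only [hpair, hproj, VEM.gradIP_sub_left, Finset.sum_sub_distrib, hconsistent, VEM.ah]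
  ring
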